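/- Let $0<\alpha<1$, $\lambda>0$, $n\ge 1$, let $\tau_1,\dots,\tau_n\ge 0$ be delays with $0<v:=\max_j\tau_j\le T$, let $b_j:[0,T]\to\mathbb R$ be continuous with $B_j=\sup_{t\in[0,T]}|b_j(t)|$, and let $g_j:C[-v,T]\to C[-v,T]$ be Lipschitz with constant $l_j\ge 0$ for the sup norm ($j=1,\dots,n$). Let $\psi\in C[-v,0]$ with $\psi(0)=0$, and consider the problem $$ {}^{C}D_{0+}^{\alpha}x(t)+\lambda x(t)=\sum_{j=1}^n b_j(t)\,g_j(x)(t-\tau_j),\quad t\in[0,T],\qquad x(t)=\psi(t),\quad t\in[-v,0], \tag{P}$$ for $x\in C[-v,T]$, where ${}^{C}D_{0+}^{\alpha}x(t)=\frac{d}{dt}\,\frac{1}{\Gamma(1-\alpha)}\int_0^t (t-s)^{-\alpha}\,(x(s)-x(0))\,ds$ is the Caputo derivative (one-sided derivatives at $t=0$ and $t=T$); the case $g_j(x)=G_j\circ x$ with $G_j:\mathbb R\to\mathbb R$ gives the terms $b_j(t)\,G_j(x(t-\tau_j))$. Assume $$ T^{\alpha}\sum_{j=1}^n B_j l_j<\Gamma(\alpha+1).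 \tag{CL}$$ Then (P) has a unique solution $x\in C[-v,T]$, and (P) is Ulam–Hyers stable with the constant $$K=\frac{T^{\alpha}}{\Gamma(\alpha+1)-T^{\alpha}\sum_{j=1}^nB_jl_j}>0:$$ for every $\varepsilon>0$ and every $y_\varepsilon\in C[-v,T]$ which has a Caputo derivative at every point of $[0,T]$, equals $\psi$ on $[-v,0]$ and satisfies $$\Big|{}^{C}D_{0+}^{\alpha}y_\varepsilon(t)+\lambda y_\varepsilon(t)-\sum_{j=1}^n b_j(t)\,g_j(y_\varepsilon)(t-\tau_j)\Big|\le\varepsilon,\qquad t\in[0,T],$$ one has $|y_\varepsilon(t)-x(t)|\le K\varepsilon$ for all $t\in[-v,T]$. -/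

import Mathlib

open scoped NNReal

noncomputable section

namespace FractionalCreep

/-- Left-sided Riemann–Liouville integral of order `β > 0` with base point `0`:
`(I^β f)(t) = 1/Γ(β) ∫₀ᵗ (t-s)^(β-1) f(s) ds`. -/
def rlIntegral (β : ℝ) (f : ℝ → ℝ) (t : ℝ) : ℝ :=
  (1 / Real.Gamma β) * ∫ s in (0 : ℝ)..t, (t - s) ^ (β - 1) * f s

/-- `f` has at `t ∈ [0,T]` the Caputo derivative `d` of order `α ∈ (0,1)`, i.e. the
Riemann–Liouville derivative of `f - f(0)`: the function `I^(1-α)(f - f(0))` has derivative `d`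
at `t` (one-sided at the end points of `[0,T]`). -/
def HasCaputoDerivAt (α T : ℝ) (f : ℝ → ℝ) (d t : ℝ) : Prop :=
  HasDerivWithinAt (rlIntegral (1 - α) (fun s => f s - f 0)) d (Set.Icc 0 T) t

/-- The value `x(t)` of `x ∈ C[-v,T]` at a real number `t ∈ [-v,T]` (zero for other `t`, which
never enter below). -/
def val {v T : ℝ} (x : C(Set.Icc (-v) T, ℝ)) (t : ℝ) : ℝ :=
  if h : t ∈ Set.Icc (-v) T then x ⟨t, h⟩ else 0

/-- The supremum of `|f|` over `[0,T]`. -/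
def supAbs (T : ℝ) (f : ℝ → ℝ) : ℝ :=
  ⨆ t : Set.Icc (0 : ℝ) T, |f t|

/-- The delayed stress `∑ⱼ bⱼ(t) (gⱼ x)(t - τⱼ)`. For an operator of the form `gⱼ x = Gⱼ ∘ x`
with `Gⱼ : ℝ → ℝ` it is `∑ⱼ bⱼ(t) Gⱼ(x(t - τⱼ))`. -/
def delayedStress {n : ℕ} {v T : ℝ} (τ : Fin n → ℝ) (b : Fin n → ℝ → ℝ)
    (g : Fin n → C(Set.Icc (-v) T, ℝ) → C(Set.Icc (-v) T, ℝ))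
    (x : C(Set.Icc (-v) T, ℝ)) (t : ℝ) : ℝ :=
  ∑ j, b j t * val (g j x) (t - τ j)

/-- `x ∈ C[-v,T]` solves `ᶜD^α x(t) + λ x(t) = ∑ⱼ bⱼ(t) (gⱼ x)(t - τⱼ)` on `[0,T]` and
`x = ψ` on `[-v,0]`. -/
def IsSolution {n : ℕ} {v T : ℝ} (α lam : ℝ) (τ : Fin n → ℝ) (b : Fin n → ℝ → ℝ)
    (g : Fin n → C(Set.Icc (-v) T, ℝ) → C(Set.Icc (-v) T, ℝ)) (ψ : ℝ → ℝ)
    (x : C(Set.Icc (-v) T, ℝ)) : Prop :=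
  (∀ t ∈ Set.Icc (-v) 0, val x t = ψ t) ∧
  ∀ t ∈ Set.Icc 0 T, ∃ d : ℝ, HasCaputoDerivAt α T (val x) d t ∧
    d + lam * val x t = delayedStress τ b g x t

/-- `y ∈ C[-v,T]` satisfies the equation on `[0,T]` up to the error `ε`, and `y = ψ` on
`[-v,0]`. -/
def IsApproxSolution {n : ℕ} {v T : ℝ} (α lam : ℝ) (τ : Fin n → ℝ) (b : Fin n → ℝ → ℝ)
    (g : Fin n → C(Set.Icc (-v) T, ℝ) → C(Set.Icc (-v) T, ℝ)) (ψ : ℝ → ℝ)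
    (ε : ℝ) (y : C(Set.Icc (-v) T, ℝ)) : Prop :=
  (∀ t ∈ Set.Icc (-v) 0, val y t = ψ t) ∧
  ∀ t ∈ Set.Icc 0 T, ∃ d : ℝ, HasCaputoDerivAt α T (val y) d t ∧
    |d + lam * val y t - delayedStress τ b g y t| ≤ ε

/-- Ulam–Hyers stability of the delayed problem with the (uniform) constant `K`. -/
def IsUlamHyersStableWith {n : ℕ} {v T : ℝ} (α lam : ℝ) (τ : Fin n → ℝ) (b : Fin n → ℝ → ℝ)
    (g : Fin n → C(Set.Icc (-v) T, ℝ) → C(Set.Icc (-v) T, ℝ)) (ψ : ℝ → ℝ) (K : ℝ) : Prop :=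
  0 < K ∧ ∀ ε : ℝ, 0 < ε → ∀ y : C(Set.Icc (-v) T, ℝ),
    IsApproxSolution α lam τ b g ψ ε y →
      ∃ x : C(Set.Icc (-v) T, ℝ), IsSolution α lam τ b g ψ x ∧
        ∀ t : Set.Icc (-v) T, |y t - x t| ≤ K * ε

end FractionalCreep

end

open scoped NNReal

namespace FractionalCreep

open Set MeasureTheory Filter Topology

/-! Since `ψ 0 = 0`, the Caputo derivative is that of `I^(1-α) x`, and inverting it turns the
problem into `u = I^α f` with `f` the fractional derivative.

Everything rests on one a priori bound (`abs_rlIntegral_le_of_abs_add_le`): if `|D^α u + λ u| ≤ N`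
and `u(0) = 0`, then `|u| ≤ N T^α / Γ(α+1)`, with no loss from `λ ≥ 0`. It follows from a comparison
principle: at a negative minimum `D^α u` would be nonpositive, whereas `D^α u ≥ -λ u > 0` there. As
`f` is only bounded and measurable, its value at the minimum is replaced by regularized averages.

The bound gives the linear solution operator the Lipschitz constant `T^α / Γ(α+1)`, uniformly in
`λ`. Continuation in `λ` from `λ = 0` therefore solves the linear problem, and under (CL) the
delayed problem is a contraction. Applied to the difference of two approximate solutions, the same
bound yields both uniqueness and the constant `K`. -/

/-! ### Power kernels and their convolutions. -/

theorem intervalIntegrable_sub_rpow {β : ℝ} (hβ : 0 < β) (a b t : ℝ) :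
    IntervalIntegrable (fun s => (t - s) ^ (β - 1)) volume a b := by
  have h : IntervalIntegrable (fun x : ℝ => x ^ (β - 1)) volume (t - a) (t - b) :=
    intervalIntegral.intervalIntegrable_rpow' (by linarith)
  simpa using h.comp_sub_left t

theorem integral_sub_rpow {β : ℝ} (hβ : 0 < β) (a b t : ℝ) :
    ∫ s in a..b, (t - s) ^ (β - 1) = ((t - a) ^ β - (t - b) ^ β) / β := by
  rw [intervalIntegral.integral_comp_sub_left (fun x => x ^ (β - 1)) t,
    integral_rpow (Or.inl (by linarith))]
  simp

theorem ofReal_beta_integrand {β t s : ℝ} (hs : s ∈ Ioc 0 t) :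
    (((t - s) ^ ((1 - β) - 1) * s ^ (β - 1) : ℝ) : ℂ) =
      (s : ℂ) ^ ((β : ℂ) - 1) * ((t : ℂ) - s) ^ ((1 - β : ℂ) - 1) := by
  have h1 : 0 ≤ t - s := by linarith [hs.2]
  rw [Complex.ofReal_mul, Complex.ofReal_cpow h1, Complex.ofReal_cpow hs.1.le, mul_comm]
  push_cast
  rfl

theorem integral_beta_kernel {β t : ℝ} (hβ0 : 0 < β) (hβ1 : β < 1) (ht : 0 < t) :
    ∫ s in (0 : ℝ)..t, (t - s) ^ ((1 - β) - 1) * s ^ (β - 1) =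
      Real.Gamma β * Real.Gamma (1 - β) := by
  have h1 := Complex.betaIntegral_scaled (β : ℂ) (1 - β : ℂ) ht
  have h2 := Complex.Gamma_mul_Gamma_eq_betaIntegral (s := (β : ℂ)) (t := (1 - β : ℂ))
    (by simpa using hβ0) (by simpa using hβ1)
  apply Complex.ofReal_injective
  rw [← intervalIntegral.integral_ofReal]
  have h3 : ∫ s in (0 : ℝ)..t, (((t - s) ^ ((1 - β) - 1) * s ^ (β - 1) : ℝ) : ℂ) =
      ∫ s in (0 : ℝ)..t, (s : ℂ) ^ ((β : ℂ) - 1) * ((t : ℂ) - s) ^ ((1 - β : ℂ) - 1) := by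
    apply intervalIntegral.integral_congr_ae
    filter_upwards with s hs
    rw [uIoc_of_le ht.le] at hs
    exact ofReal_beta_integrand hs
  rw [h3, h1]
  have h4 : (β : ℂ) + (1 - β) = 1 := by ring
  rw [h4, Complex.Gamma_one, one_mul] at h2
  rw [h4, sub_self, Complex.cpow_zero, one_mul, ← h2]
  push_cast
  rw [← Complex.Gamma_ofReal, ← Complex.Gamma_ofReal]
  push_cast
  rfl

theorem intervalIntegrable_beta_kernel {β t : ℝ} (hβ0 : 0 < β) (hβ1 : β < 1) (ht : 0 < t) :
    IntervalIntegrable (fun s => (t - s) ^ ((1 - β) - 1) * s ^ (β - 1)) volume 0 t := by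
  by_contra h
  have h1 := integral_beta_kernel hβ0 hβ1 ht
  -- A non-integrable function has integral `0` by convention, but the beta integral is positive.
  rw [intervalIntegral.integral_undef h] at h1
  have := Real.Gamma_pos_of_pos hβ0
  have := Real.Gamma_pos_of_pos (sub_pos.2 hβ1)
  have : 0 < Real.Gamma β * Real.Gamma (1 - β) := by positivity
  linarith

theorem intervalIntegrable_shifted_kernel {β t ε : ℝ} (hβ0 : 0 < β) (ht : 0 < t) (hε : 0 < ε) :
    IntervalIntegrable (fun s => (t - s + ε) ^ (-β - 1) * s ^ (β - 1)) volume 0 t := by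
  have h : IntervalIntegrable (fun x : ℝ => x ^ (β - 1)) volume 0 t :=
    intervalIntegral.intervalIntegrable_rpow' (by linarith)
  refine h.continuousOn_mul ?_
  rw [uIcc_of_le ht.le]
  refine ContinuousOn.rpow_const (by fun_prop) fun s hs => Or.inl ?_
  linarith [hs.2]

/-- The quotient `s / (t - s + ε)` has derivative `(t + ε) / (t - s + ε)^2`, so its `β`-th power is
an antiderivative up to a constant factor. -/
theorem integral_shifted_kernel {β t ε : ℝ} (hβ0 : 0 < β) (ht : 0 < t) (hε : 0 < ε) :
    ∫ s in (0 : ℝ)..t, (t - s + ε) ^ (-β - 1) * s ^ (β - 1) =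
      ε ^ (-β) * t ^ β / (β * (t + ε)) := by
  have hden : ∀ s ∈ Icc 0 t, 0 < t - s + ε := fun s hs => by linarith [hs.2]
  rw [intervalIntegral.integral_eq_sub_of_hasDerivAt_of_le (f := fun s =>
    (s / (t - s + ε)) ^ β / (β * (t + ε))) ht.le]
  · simp only [sub_self, zero_add, zero_div, Real.zero_rpow hβ0.ne', sub_zero]
    rw [Real.div_rpow ht.le hε.le, Real.rpow_neg hε.le]
    ring
  · refine ContinuousOn.div_const (ContinuousOn.rpow_const ?_ fun s hs => Or.inr hβ0.le) _
    exact ContinuousOn.div (by fun_prop) (by fun_prop) fun s hs => (hden s hs).ne'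
  · intro s hs
    have hd := hden s (Ioo_subset_Icc_self hs)
    have hs0 : 0 < s := hs.1
    have h1 : HasDerivAt (fun s => t - s + ε) (-1) s := by
      simpa using ((hasDerivAt_id s).const_sub t).add_const ε
    have h2 := (((hasDerivAt_id s).div h1 hd.ne').rpow_const (p := β)
      (Or.inl (div_pos hs0 hd).ne')).div_const (β * (t + ε))
    refine h2.congr_deriv ?_
    simp only [id, Pi.div_apply]
    rw [Real.div_rpow hs0.le hd.le, Real.rpow_sub hd β, Real.rpow_sub hd (-β),
      Real.rpow_neg hd.le, Real.rpow_sub hs0]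
    have := Real.rpow_pos_of_pos hd β
    have : 0 < t + ε := by linarith
    simp only [Real.rpow_one]
    field_simp
    ring
  · exact intervalIntegrable_shifted_kernel hβ0 ht hε

/-- Associativity of the convolution on a half-line, for nonnegative kernels. -/
theorem integral_kernel_assoc {A B C f : ℝ → ℝ} {M t : ℝ} (ht : 0 ≤ t)
    (hA : Measurable A) (hB : Measurable B) (hf : Measurable f)
    (hA0 : ∀ x, 0 < x → 0 ≤ A x) (hB0 : ∀ x, 0 < x → 0 ≤ B x)
    (hAB : ∀ x ∈ Ioc 0 t, IntervalIntegrable (fun s => A (x - s) * B s) volume 0 x)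
    (hC : ∀ x ∈ Ioc 0 t, ∫ s in (0 : ℝ)..x, A (x - s) * B s = C x)
    (hCi : IntervalIntegrable C volume 0 t) (hM : ∀ s, |f s| ≤ M) :
    ∫ s in (0 : ℝ)..t, A (t - s) * ∫ r in (0 : ℝ)..s, B (s - r) * f r =
      ∫ r in (0 : ℝ)..t, C (t - r) * f r := by
  set μ := volume.restrict (Ioo 0 t) with hμ
  -- Extension by zero off the triangle `r < s` allows Fubini on the square.
  set F : ℝ → ℝ → ℝ := fun r s => if r < s then A (t - s) * B (s - r) * f r else 0 with hF
  have hFm : Measurable (Function.uncurry F) := by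
    refine Measurable.ite (measurableSet_lt measurable_fst measurable_snd) ?_ measurable_const
    fun_prop
  -- sections with fixed `r`
  have hshift : ∀ r ∈ Ioo 0 t, ∫ s in r..t, A (t - s) * B (s - r) = C (t - r) := by
    intro r hr
    rw [← hC (t - r) ⟨by linarith [hr.2], by linarith [hr.1]⟩]
    have := intervalIntegral.integral_comp_sub_right (a := r) (b := t)
      (fun s => A (t - r - s) * B s) r
    simpa using this
  have hshifti : ∀ r ∈ Ioo 0 t,
      IntervalIntegrable (fun s => A (t - s) * B (s - r)) volume r t := by
    intro r hr
    have := (hAB (t - r) ⟨by linarith [hr.2], by linarith [hr.1]⟩).comp_sub_right r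
    simpa using this
  have hsec : ∀ (c : ℝ), ∀ r ∈ Ioo 0 t,
      (Ioo 0 t).indicator (fun s => if r < s then A (t - s) * B (s - r) * c else 0) =
      (Ioo r t).indicator fun s => A (t - s) * B (s - r) * c := by
    intro c r hr
    ext s
    by_cases h1 : r < s <;> by_cases h2 : s < t <;> simp [indicator, h1, h2]
    intro h3; linarith [hr.1]
  -- The constant `c` stays free: the value of the section integral is needed both for `f r` and for
  -- `|f r|`.
  have hint : ∀ (c : ℝ), ∀ r ∈ Ioo 0 t,
      Integrable (fun s => if r < s then A (t - s) * B (s - r) * c else 0) μ := by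
    intro c r hr
    change IntegrableOn _ (Ioo 0 t) volume
    rw [← integrable_indicator_iff measurableSet_Ioo, hsec c r hr,
      integrable_indicator_iff measurableSet_Ioo,
      ← intervalIntegrable_iff_integrableOn_Ioo_of_le hr.2.le]
    exact (hshifti r hr).mul_const c
  have hval : ∀ (c : ℝ), ∀ r ∈ Ioo 0 t,
      ∫ s, (if r < s then A (t - s) * B (s - r) * c else 0) ∂μ = C (t - r) * c := by
    intro c r hr
    rw [hμ, ← integral_indicator measurableSet_Ioo, hsec c r hr,
      integral_indicator measurableSet_Ioo, ← integral_Ioc_eq_integral_Ioo,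
      ← intervalIntegral.integral_of_le hr.2.le, intervalIntegral.integral_mul_const,
      hshift r hr]
  have hnorm : ∀ r ∈ Ioo 0 t, ∫ s, ‖F r s‖ ∂μ = C (t - r) * |f r| := by
    intro r hr
    rw [← hval |f r| r hr]
    apply setIntegral_congr_fun measurableSet_Ioo
    intro s hs
    simp only [hF]
    split_ifs with h
    · rw [Real.norm_eq_abs, abs_mul, abs_of_nonneg]
      exact mul_nonneg (hA0 _ (by linarith [hs.2])) (hB0 _ (by linarith))
    · simp
  have hCi' : IntervalIntegrable (fun r => C (t - r)) volume 0 t := by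
    simpa using (hCi.comp_sub_left t).symm
  have hCf : ∀ h : ℝ → ℝ, Measurable h → (∀ s, |h s| ≤ M) →
      Integrable (fun r => C (t - r) * h r) μ := by
    intro h hh hhM
    have h1 : IntegrableOn (fun r => C (t - r)) (Ioo 0 t) volume :=
      (intervalIntegrable_iff_integrableOn_Ioo_of_le ht).1 hCi'
    exact h1.mul_bdd (c := M) hh.aestronglyMeasurable (ae_of_all _ hhM)
  have hFi : Integrable (Function.uncurry F) (μ.prod μ) := by
    rw [integrable_prod_iff hFm.aestronglyMeasurable]
    constructor
    · refine (ae_restrict_mem measurableSet_Ioo).mono fun r hr => hint (f r) r hr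
    · refine (hCf (fun r => |f r|) (by fun_prop) (by simpa using hM)).congr ?_
      refine (ae_restrict_mem measurableSet_Ioo).mono fun r hr => (hnorm r hr).symm
  have hswap := integral_integral_swap hFi
  rw [intervalIntegral.integral_of_le ht, intervalIntegral.integral_of_le ht,
    integral_Ioc_eq_integral_Ioo, integral_Ioc_eq_integral_Ioo]
  calc ∫ s in Ioo 0 t, A (t - s) * ∫ r in (0 : ℝ)..s, B (s - r) * f r
      = ∫ s, ∫ r, F r s ∂μ ∂μ := by
        apply setIntegral_congr_fun measurableSet_Ioo
        intro s hs
        simp only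
        rw [← intervalIntegral.integral_const_mul, intervalIntegral.integral_of_le hs.1.le,
          integral_Ioc_eq_integral_Ioo, ← integral_indicator measurableSet_Ioo, hμ,
          ← integral_indicator measurableSet_Ioo]
        congr 1
        ext r
        by_cases h1 : r < s <;> by_cases h2 : 0 < r <;> simp [indicator, h1, h2, hF, mul_assoc]
        intro h3; linarith [hs.2]
    _ = ∫ r, ∫ s, F r s ∂μ ∂μ := hswap.symm
    _ = ∫ r in Ioo 0 t, C (t - r) * f r :=
        setIntegral_congr_fun measurableSet_Ioo fun r hr => hval (f r) r hr

/-! ### Riemann–Liouville integrals: linearity, Hölder continuity, semigroup law. -/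

theorem rlIntegral_congr {β t : ℝ} {f g : ℝ → ℝ} (ht : 0 ≤ t) (h : ∀ s ∈ Ioo 0 t, f s = g s) :
    rlIntegral β f t = rlIntegral β g t := by
  unfold rlIntegral
  rw [intervalIntegral.integral_of_le ht, intervalIntegral.integral_of_le ht,
    integral_Ioc_eq_integral_Ioo, integral_Ioc_eq_integral_Ioo]
  congr 1
  exact setIntegral_congr_fun measurableSet_Ioo fun s hs => by simp only [h s hs]

@[simp]
theorem rlIntegral_zero_right (β : ℝ) (f : ℝ → ℝ) : rlIntegral β f 0 = 0 := by
  simp [rlIntegral]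

theorem intervalIntegrable_kernel_mul {β M : ℝ} {f : ℝ → ℝ} (hβ : 0 < β) (hf : Measurable f)
    (hM : ∀ s, |f s| ≤ M) (a b t : ℝ) :
    IntervalIntegrable (fun s => (t - s) ^ (β - 1) * f s) volume a b := by
  have h := intervalIntegrable_sub_rpow hβ a b t
  rw [intervalIntegrable_iff] at h ⊢
  exact h.mul_bdd (c := M) hf.aestronglyMeasurable (ae_of_all _ hM)

theorem rlIntegral_const {β : ℝ} (hβ : 0 < β) (c t : ℝ) :
    rlIntegral β (fun _ => c) t = c * t ^ β / Real.Gamma (β + 1) := by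
  unfold rlIntegral
  rw [intervalIntegral.integral_mul_const, integral_sub_rpow hβ, Real.Gamma_add_one hβ.ne',
    sub_self, Real.zero_rpow hβ.ne']
  have := Real.Gamma_pos_of_pos hβ
  field_simp
  rw [sub_zero, sub_zero, mul_comm]

theorem rlIntegral_add {β M N : ℝ} {f g : ℝ → ℝ} (hβ : 0 < β) (hf : Measurable f)
    (hM : ∀ s, |f s| ≤ M) (hg : Measurable g) (hN : ∀ s, |g s| ≤ N) (t : ℝ) :
    rlIntegral β (fun s => f s + g s) t = rlIntegral β f t + rlIntegral β g t := by
  unfold rlIntegral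
  rw [← mul_add, ← intervalIntegral.integral_add (intervalIntegrable_kernel_mul hβ hf hM 0 t t)
    (intervalIntegrable_kernel_mul hβ hg hN 0 t t)]
  simp only [mul_add]

theorem rlIntegral_const_mul (β c : ℝ) (f : ℝ → ℝ) (t : ℝ) :
    rlIntegral β (fun s => c * f s) t = c * rlIntegral β f t := by
  unfold rlIntegral
  simp only [mul_left_comm _ c, intervalIntegral.integral_const_mul]

/-- The kernel decreases when `s` is replaced by `t`, so the change over `[0,s]` and the new piece
over `[s,t]` both integrate explicitly; the leftover `s^β - t^β ≤ 0` is dropped. -/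
theorem abs_rlIntegral_sub_le {β M : ℝ} {f : ℝ → ℝ} (hβ0 : 0 < β) (hβ1 : β < 1)
    (hf : Measurable f) (hM : ∀ s, |f s| ≤ M) {s t : ℝ} (hs : 0 ≤ s) (hst : s ≤ t) :
    |rlIntegral β f t - rlIntegral β f s| ≤ 2 * M / Real.Gamma (β + 1) * (t - s) ^ β := by
  have hΓ := Real.Gamma_pos_of_pos hβ0
  have hM0 : 0 ≤ M := (abs_nonneg _).trans (hM 0)
  have hI := fun a b t => intervalIntegrable_kernel_mul hβ0 hf hM a b t
  have hk := fun a b t => intervalIntegrable_sub_rpow hβ0 a b t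
  have hsplit : rlIntegral β f t - rlIntegral β f s = 1 / Real.Gamma β *
      ((∫ r in (0 : ℝ)..s, ((t - r) ^ (β - 1) - (s - r) ^ (β - 1)) * f r) +
        ∫ r in s..t, (t - r) ^ (β - 1) * f r) := by
    unfold rlIntegral
    simp only [sub_mul]
    rw [intervalIntegral.integral_sub (hI 0 s t) (hI 0 s s),
      ← intervalIntegral.integral_add_adjacent_intervals (hI 0 s t) (hI s t t)]
    ring
  have h1 : |∫ r in (0 : ℝ)..s, ((t - r) ^ (β - 1) - (s - r) ^ (β - 1)) * f r| ≤
      ∫ r in (0 : ℝ)..s, ((s - r) ^ (β - 1) - (t - r) ^ (β - 1)) * M := by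
    rw [← Real.norm_eq_abs]
    refine intervalIntegral.norm_integral_le_of_norm_le hs ?_
      (((hk 0 s s).sub (hk 0 s t)).mul_const M)
    -- At `r = s` the convention `0 ^ (β - 1) = 0` would break the monotonicity of the kernel.
    have hne : ∀ᵐ r : ℝ, r ≠ s := by simp [ae_iff]
    filter_upwards [hne] with r hrs hr
    have hr' : 0 < s - r := sub_pos.2 (lt_of_le_of_ne hr.2 hrs)
    have hle : (t - r) ^ (β - 1) ≤ (s - r) ^ (β - 1) :=
      Real.rpow_le_rpow_of_nonpos hr' (by linarith) (by linarith)
    rw [norm_mul, Real.norm_eq_abs, abs_sub_comm, abs_of_nonneg (sub_nonneg.2 hle)]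
    exact mul_le_mul_of_nonneg_left (hM r) (sub_nonneg.2 hle)
  have h2 : |∫ r in s..t, (t - r) ^ (β - 1) * f r| ≤ ∫ r in s..t, (t - r) ^ (β - 1) * M := by
    rw [← Real.norm_eq_abs]
    refine intervalIntegral.norm_integral_le_of_norm_le hst ?_ ((hk s t t).mul_const M)
    refine ae_of_all _ fun r hr => ?_
    have h0 : 0 ≤ (t - r) ^ (β - 1) := Real.rpow_nonneg (by linarith [hr.2]) _
    rw [norm_mul, Real.norm_eq_abs, abs_of_nonneg h0]
    exact mul_le_mul_of_nonneg_left (hM r) h0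
  rw [intervalIntegral.integral_mul_const, intervalIntegral.integral_sub (hk 0 s s) (hk 0 s t),
    integral_sub_rpow hβ0, integral_sub_rpow hβ0] at h1
  rw [intervalIntegral.integral_mul_const, integral_sub_rpow hβ0] at h2
  simp only [sub_self, sub_zero, Real.zero_rpow hβ0.ne'] at h1 h2
  have h3 : s ^ β ≤ t ^ β := Real.rpow_le_rpow hs hst hβ0.le
  rw [hsplit, abs_mul, abs_of_pos (by positivity), Real.Gamma_add_one hβ0.ne']
  refine (mul_le_mul_of_nonneg_left ((abs_add_le _ _).trans (add_le_add h1 h2))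
    (by positivity)).trans ?_
  have h4 : (s ^ β / β - (t ^ β - (t - s) ^ β) / β) * M + (t - s) ^ β / β * M ≤
      2 * M * (t - s) ^ β / β := by
    have : (s ^ β - t ^ β) * M / β ≤ 0 :=
      div_nonpos_of_nonpos_of_nonneg (mul_nonpos_of_nonpos_of_nonneg (by linarith) hM0) hβ0.le
    calc _ = (s ^ β - t ^ β) * M / β + 2 * M * (t - s) ^ β / β := by ring
      _ ≤ _ := by linarith
  refine (mul_le_mul_of_nonneg_left h4 (by positivity)).trans (le_of_eq ?_)
  field_simp

theorem continuousOn_rlIntegral {β M : ℝ} {f : ℝ → ℝ} (hβ0 : 0 < β) (hβ1 : β < 1)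
    (hf : Measurable f) (hM : ∀ s, |f s| ≤ M) : ContinuousOn (rlIntegral β f) (Ici 0) := by
  have hle : ∀ s ∈ Ici (0 : ℝ), ∀ t ∈ Ici (0 : ℝ), |rlIntegral β f t - rlIntegral β f s| ≤
      2 * M / Real.Gamma (β + 1) * |t - s| ^ β := by
    intro s hs t ht
    rcases le_total s t with h | h
    · rw [abs_of_nonneg (sub_nonneg.2 h)]
      exact abs_rlIntegral_sub_le hβ0 hβ1 hf hM hs h
    · rw [abs_sub_comm, abs_sub_comm t s, abs_of_nonneg (sub_nonneg.2 h)]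
      exact abs_rlIntegral_sub_le hβ0 hβ1 hf hM ht h
  intro s hs
  rw [ContinuousWithinAt, tendsto_iff_norm_sub_tendsto_zero]
  have hlim : Tendsto (fun t : ℝ => 2 * M / Real.Gamma (β + 1) * |t - s| ^ β) (𝓝[Ici 0] s)
      (𝓝 0) := by
    have hc : Continuous fun t : ℝ => 2 * M / Real.Gamma (β + 1) * |t - s| ^ β :=
      continuous_const.mul (Continuous.rpow_const (by fun_prop) fun _ => Or.inr hβ0.le)
    have := (hc.tendsto s).mono_left (nhdsWithin_le_nhds (s := Ici 0))
    simpa [Real.zero_rpow hβ0.ne'] using this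
  refine squeeze_zero' (Eventually.of_forall fun _ => norm_nonneg _) ?_ hlim
  filter_upwards [self_mem_nhdsWithin] with t ht using hle s hs t ht

/-- The semigroup law for complementary orders. -/
theorem rlIntegral_rlIntegral {β M t : ℝ} {f : ℝ → ℝ} (hβ0 : 0 < β) (hβ1 : β < 1)
    (hf : Measurable f) (hM : ∀ s, |f s| ≤ M) (ht : 0 ≤ t) :
    rlIntegral (1 - β) (rlIntegral β f) t = ∫ s in (0 : ℝ)..t, f s := by
  -- The exponents are complementary, so the convolved kernel is constant.
  have h := integral_kernel_assoc (A := fun x => x ^ ((1 - β) - 1)) (B := fun x => x ^ (β - 1))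
    (C := fun _ => Real.Gamma β * Real.Gamma (1 - β)) ht (by fun_prop) (by fun_prop) hf
    (fun x hx => Real.rpow_nonneg hx.le _) (fun x hx => Real.rpow_nonneg hx.le _)
    (fun x hx => intervalIntegrable_beta_kernel hβ0 hβ1 hx.1)
    (fun x hx => integral_beta_kernel hβ0 hβ1 hx.1) (by simp) hM
  have h1 := Real.Gamma_pos_of_pos hβ0
  have h2 := Real.Gamma_pos_of_pos (sub_pos.2 hβ1)
  unfold rlIntegral
  simp only [mul_left_comm _ (1 / Real.Gamma β), intervalIntegral.integral_const_mul] at h ⊢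
  rw [h]
  field_simp

/-! ### Inversion between fractional derivatives and integrals. -/

theorem eqOn_of_forall_integral_eq {T : ℝ} {f g : ℝ → ℝ} (hT : 0 < T) (hf : Continuous f)
    (hg : Continuous g)
    (h : ∀ t ∈ Icc 0 T, ∫ s in (0 : ℝ)..t, f s = ∫ s in (0 : ℝ)..t, g s) :
    EqOn f g (Icc 0 T) := by
  intro t ht
  have h1 : HasDerivWithinAt (fun t => ∫ s in (0 : ℝ)..t, f s) (f t) (Icc 0 T) t :=
    (hf.integral_hasStrictDerivAt 0 t).hasDerivAt.hasDerivWithinAt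
  have h2 : HasDerivWithinAt (fun t => ∫ s in (0 : ℝ)..t, g s) (g t) (Icc 0 T) t :=
    (hg.integral_hasStrictDerivAt 0 t).hasDerivAt.hasDerivWithinAt
  exact (uniqueDiffOn_Icc hT t ht).eq_deriv _ h1 (h2.congr h (h t ht))

/-- The integrals only see `[0,T]`, but the lemmas on `rlIntegral` require globally measurable,
bounded functions. -/
theorem exists_continuous_bounded_extension {T : ℝ} {f : ℝ → ℝ} (hT : 0 ≤ T)
    (hf : ContinuousOn f (Icc 0 T)) :
    ∃ g : ℝ → ℝ, Continuous g ∧ EqOn f g (Icc 0 T) ∧ ∃ M, ∀ s, |g s| ≤ M := by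
  obtain ⟨M, hM⟩ := isCompact_Icc.exists_bound_of_continuousOn hf
  refine ⟨IccExtend hT ((Icc 0 T).domRestrict f), ?_, ?_, M, ?_⟩
  · exact (continuousOn_iff_continuous_domRestrict.1 hf).Icc_extend'
  · intro s hs
    rw [IccExtend_of_mem hT _ hs]
    rfl
  · intro s
    exact hM _ (projIcc 0 T hT s).2

theorem hasDerivWithinAt_rlIntegral_of_eqOn {α T t : ℝ} {f u : ℝ → ℝ} (hα0 : 0 < α) (hα1 : α < 1)
    (hT : 0 ≤ T) (hf : ContinuousOn f (Icc 0 T)) (hu : EqOn u (rlIntegral α f) (Icc 0 T))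
    (ht : t ∈ Icc 0 T) :
    HasDerivWithinAt (rlIntegral (1 - α) u) (f t) (Icc 0 T) t := by
  obtain ⟨g, hg, hfg, M, hM⟩ := exists_continuous_bounded_extension hT hf
  have key : ∀ s ∈ Icc 0 T, rlIntegral (1 - α) u s = ∫ r in (0 : ℝ)..s, g r := by
    intro s hs
    rw [← rlIntegral_rlIntegral hα0 hα1 hg.measurable hM hs.1]
    refine rlIntegral_congr hs.1 fun r hr => ?_
    have hr' : r ∈ Icc 0 T := ⟨hr.1.le, hr.2.le.trans hs.2⟩
    rw [hu hr']
    exact rlIntegral_congr hr.1.le fun q hq => hfg ⟨hq.1.le, hq.2.le.trans hr'.2⟩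
  rw [hfg ht]
  exact ((hg.integral_hasStrictDerivAt 0 t).hasDerivAt.hasDerivWithinAt).congr key (key t ht)

/-- A continuous function with a bounded Riemann–Liouville derivative is the fractional integral
of that derivative. -/
theorem exists_eqOn_rlIntegral_of_hasDerivWithinAt {α T M : ℝ} {d u : ℝ → ℝ} (hα0 : 0 < α)
    (hα1 : α < 1) (hT : 0 < T) (hu : ContinuousOn u (Icc 0 T))
    (hd : ∀ t ∈ Icc 0 T, HasDerivWithinAt (rlIntegral (1 - α) u) (d t) (Icc 0 T) t)
    (hM : ∀ t ∈ Icc 0 T, |d t| ≤ M) :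
    ∃ f : ℝ → ℝ, Measurable f ∧ (∀ s, |f s| ≤ M) ∧ EqOn f d (Ioo 0 T) ∧
      EqOn u (rlIntegral α f) (Icc 0 T) := by
  have hM0 : 0 ≤ M := (abs_nonneg _).trans (hM 0 ⟨le_rfl, hT.le⟩)
  set P := rlIntegral (1 - α) u with hP
  -- `d` is not known to be measurable, whereas `deriv P` always is, and the two agree inside the
  -- interval.
  set f := (Ioo 0 T).indicator (deriv P) with hf
  have hder : ∀ t ∈ Ioo 0 T, HasDerivAt P (d t) t := fun t ht =>
    (hd t (Ioo_subset_Icc_self ht)).hasDerivAt (Icc_mem_nhds ht.1 ht.2)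
  have hfd : EqOn f d (Ioo 0 T) := fun t ht => by
    rw [hf, indicator_of_mem ht, (hder t ht).deriv]
  have hfm : Measurable f := (measurable_deriv P).indicator measurableSet_Ioo
  have hfM : ∀ s, |f s| ≤ M := by
    intro s
    by_cases hs : s ∈ Ioo 0 T
    · rw [hfd hs]
      exact hM s (Ioo_subset_Icc_self hs)
    · rw [hf, indicator_of_notMem hs, abs_zero]
      exact hM0
  have hPf : ∀ t ∈ Icc 0 T, P t = ∫ s in (0 : ℝ)..t, f s := by
    intro t ht
    rw [intervalIntegral.integral_eq_sub_of_hasDerivAt_of_le ht.1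
      (f := P) (fun s hs => ((hd s ⟨hs.1, hs.2.trans ht.2⟩).continuousWithinAt).mono
        (Icc_subset_Icc_right ht.2))]
    · simp [hP]
    · intro s hs
      have hs' : s ∈ Ioo 0 T := ⟨hs.1, hs.2.trans_le ht.2⟩
      rw [hfd hs']
      exact hder s hs'
    · rw [intervalIntegrable_iff]
      exact Measure.integrableOn_of_bounded (M := M) (by simp) hfm.aestronglyMeasurable
        (ae_of_all _ hfM)
  refine ⟨f, hfm, hfM, hfd, ?_⟩
  obtain ⟨v, hv, huv, Mv, hMv⟩ := exists_continuous_bounded_extension hT.le hu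
  obtain ⟨w, hw, hfw, Mw, hMw⟩ := exists_continuous_bounded_extension hT.le
    ((continuousOn_rlIntegral hα0 hα1 hfm hfM).mono fun s (hs : s ∈ Icc 0 T) => hs.1)
  -- Injectivity of `I^(1-α)` on continuous functions: applying `I^α` leaves ordinary primitives,
  -- which determine the functions.
  have hvw : EqOn v w (Icc 0 T) := by
    refine eqOn_of_forall_integral_eq hT hv hw fun t ht => ?_
    rw [← rlIntegral_rlIntegral (β := 1 - α) (by linarith) (by linarith) hv.measurable hMv ht.1,
      ← rlIntegral_rlIntegral (β := 1 - α) (by linarith) (by linarith) hw.measurable hMw ht.1]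
    refine rlIntegral_congr ht.1 fun s hs => ?_
    have hs' : s ∈ Icc 0 T := ⟨hs.1.le, hs.2.le.trans ht.2⟩
    calc rlIntegral (1 - α) v s = P s := rlIntegral_congr hs.1.le fun r hr =>
          (huv ⟨hr.1.le, hr.2.le.trans hs'.2⟩).symm
      _ = rlIntegral (1 - α) (rlIntegral α f) s := by
          rw [hPf s hs', rlIntegral_rlIntegral hα0 hα1 hfm hfM hs'.1]
      _ = rlIntegral (1 - α) w s := rlIntegral_congr hs.1.le fun r hr =>
          hfw ⟨hr.1.le, hr.2.le.trans hs'.2⟩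
  exact (huv.trans hvw).trans hfw.symm

/-! ### Comparison principle and a priori bound. -/

theorem integral_shifted_mul_rlIntegral {α M t ε : ℝ} {f : ℝ → ℝ} (hα0 : 0 < α) (ht : 0 < t)
    (hε : 0 < ε) (hf : Measurable f) (hM : ∀ s, |f s| ≤ M) :
    ∫ s in (0 : ℝ)..t, (t - s + ε) ^ (-α - 1) * rlIntegral α f s =
      1 / Real.Gamma α *
        ∫ r in (0 : ℝ)..t, ε ^ (-α) * (t - r) ^ α / (α * (t - r + ε)) * f r := by
  have hA : ∀ x : ℝ, 0 < x → 0 ≤ (x + ε) ^ (-α - 1) := fun x hx =>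
    Real.rpow_nonneg (by linarith) _
  have hC : IntervalIntegrable (fun x => ε ^ (-α) * x ^ α / (α * (x + ε))) volume 0 t := by
    refine ContinuousOn.intervalIntegrable ?_
    rw [uIcc_of_le ht.le]
    refine ContinuousOn.div ?_ (by fun_prop) fun x hx => ?_
    · exact continuousOn_const.mul
        (ContinuousOn.rpow_const continuousOn_id fun x _ => Or.inr hα0.le)
    · have : 0 < x + ε := by linarith [hx.1]
      positivity
  have h := integral_kernel_assoc (A := fun x => (x + ε) ^ (-α - 1)) (B := fun x => x ^ (α - 1))
    (C := fun x => ε ^ (-α) * x ^ α / (α * (x + ε))) ht.le (by fun_prop) (by fun_prop) hf hA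
    (fun x hx => Real.rpow_nonneg hx.le _)
    (fun x hx => intervalIntegrable_shifted_kernel hα0 hx.1 hε)
    (fun x hx => integral_shifted_kernel hα0 hx.1 hε) hC hM
  rw [← h, ← intervalIntegral.integral_const_mul]
  simp only [rlIntegral, mul_left_comm]

theorem intervalIntegrable_regularized_kernel_mul {α M t ε : ℝ} {f : ℝ → ℝ} (hα0 : 0 < α)
    (hε : 0 < ε) (hf : Measurable f) (hM : ∀ s, |f s| ≤ M) {a b : ℝ} (hab : a ≤ b) (hbt : b ≤ t) :
    IntervalIntegrable (fun r => (t - r) ^ (α - 1) / (t - r + ε) * f r) volume a b := by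
  have h := (intervalIntegrable_kernel_mul hα0 hf hM a b t).continuousOn_mul
    (g := fun r => (t - r + ε)⁻¹) ?_
  · refine h.congr ?_
    intro r _
    simp only
    ring
  · rw [uIcc_of_le hab]
    refine ContinuousOn.inv₀ (by fun_prop) fun r hr => ?_
    linarith [hr.2]

/-- At a nonpositive minimum of `u = I^α f`, a family of positive averages of `f` is nonpositive. -/
theorem integral_regularized_kernel_nonpos {α M t ε : ℝ} {f : ℝ → ℝ} (hα0 : 0 < α)
    (ht : 0 < t) (hε : 0 < ε) (hf : Measurable f) (hM : ∀ s, |f s| ≤ M)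
    (hu : ContinuousOn (rlIntegral α f) (Icc 0 t))
    (hmin : ∀ s ∈ Icc 0 t, rlIntegral α f t ≤ rlIntegral α f s) (hneg : rlIntegral α f t ≤ 0) :
    ∫ r in (0 : ℝ)..t, (t - r) ^ (α - 1) / (t - r + ε) * f r ≤ 0 := by
  set u := rlIntegral α f with hu_def
  have hΓ := Real.Gamma_pos_of_pos hα0
  have hw : ContinuousOn (fun s : ℝ => (t - s + ε) ^ (-α - 1)) (Icc 0 t) :=
    ContinuousOn.rpow_const (by fun_prop) fun s hs => Or.inl (by linarith [hs.2])
  have hwint : ∫ s in (0 : ℝ)..t, (t - s + ε) ^ (-α - 1) =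
      (ε ^ (-α) - (t + ε) ^ (-α)) / α := by
    have h := intervalIntegral.integral_comp_sub_left (a := 0) (b := t)
      (fun x : ℝ => x ^ (-α - 1)) (t + ε)
    have h2 : ∀ s : ℝ, t + ε - s = t - s + ε := fun s => by ring
    simp only [h2] at h
    rw [h, integral_rpow (Or.inr ⟨by linarith, ?_⟩)]
    · simp only [sub_self, zero_add, sub_zero, sub_add_cancel]
      rw [div_neg, ← neg_div, neg_sub]
    · rw [uIcc_of_le (by linarith)]
      intro h0
      linarith [h0.1]
  -- The weight is nonnegative, so `u s` may be replaced by its minimum; `u t ≤ 0` then permits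
  -- dropping `(t + ε) ^ (-α)`.
  have h1 : (ε ^ (-α) / α) * u t ≤ ∫ s in (0 : ℝ)..t, (t - s + ε) ^ (-α - 1) * u s := by
    have hle : ∫ s in (0 : ℝ)..t, (t - s + ε) ^ (-α - 1) * u t ≤
        ∫ s in (0 : ℝ)..t, (t - s + ε) ^ (-α - 1) * u s := by
      refine intervalIntegral.integral_mono_on ht.le ?_ ?_ fun s hs =>
        mul_le_mul_of_nonneg_left (hmin s hs) (Real.rpow_nonneg (by linarith [hs.2]) _)
      · exact ContinuousOn.intervalIntegrable (by
          rw [uIcc_of_le ht.le]; exact hw.mul continuousOn_const)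
      · exact ContinuousOn.intervalIntegrable (by rw [uIcc_of_le ht.le]; exact hw.mul hu)
    refine le_trans ?_ hle
    rw [intervalIntegral.integral_mul_const, hwint]
    refine mul_le_mul_of_nonpos_right ?_ hneg
    have := Real.rpow_nonneg (show 0 ≤ t + ε by linarith) (-α)
    gcongr
    linarith
  rw [hu_def, integral_shifted_mul_rlIntegral hα0 ht hε hf hM] at h1
  conv_lhs at h1 => rw [rlIntegral]
  have hεp := Real.rpow_pos_of_pos hε (-α)
  have hint1 := (intervalIntegrable_kernel_mul hα0 hf hM 0 t t).const_mul (ε ^ (-α) / α)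
  have hint2 := (intervalIntegrable_regularized_kernel_mul (t := t) hα0 hε hf hM ht.le
    le_rfl).const_mul (ε ^ (-α) / α * ε)
  -- Writing `(t-r) / (t-r+ε) = 1 - ε / (t-r+ε)` splits off a term equal to the left side of `h1`;
  -- what remains is the sign of the regularized average.
  have hid : ∀ᵐ r : ℝ, r ∈ uIoc 0 t →
      ε ^ (-α) * (t - r) ^ α / (α * (t - r + ε)) * f r =
      ε ^ (-α) / α * ((t - r) ^ (α - 1) * f r) -
        ε ^ (-α) / α * ε * ((t - r) ^ (α - 1) / (t - r + ε) * f r) := by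
    have hne : ∀ᵐ r : ℝ, r ≠ t := by simp [ae_iff]
    filter_upwards [hne] with r hrt hr
    rw [uIoc_of_le ht.le] at hr
    have hr' : 0 < t - r := sub_pos.2 (lt_of_le_of_ne hr.2 hrt)
    have hd : 0 < t - r + ε := by linarith
    have : (t - r) ^ α = (t - r) ^ (α - 1) * (t - r) := by
      rw [← Real.rpow_add_one hr'.ne']; simp
    rw [this]
    field_simp
    ring
  rw [intervalIntegral.integral_congr_ae hid, intervalIntegral.integral_sub hint1 hint2,
    intervalIntegral.integral_const_mul, intervalIntegral.integral_const_mul] at h1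
  set I := ∫ r in (0 : ℝ)..t, (t - r) ^ (α - 1) / (t - r + ε) * f r
  have h2 : 1 / Real.Gamma α * (ε ^ (-α) / α * ε) * I ≤ 0 := by linarith
  have h3 : 0 < 1 / Real.Gamma α * (ε ^ (-α) / α * ε) := by positivity
  exact nonpos_of_mul_nonpos_right h2 h3

/-- If `f` is bounded below and positive near `t`, its regularized averages at `t` are eventually
positive. -/
theorem exists_integral_regularized_kernel_pos {α M t δ c : ℝ} {f : ℝ → ℝ} (hα0 : 0 < α)
    (hα1 : α < 1) (hδ : 0 < δ) (hδt : δ ≤ t) (hc : 0 < c) (hf : Measurable f)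
    (hM : ∀ s, |f s| ≤ M) (hfc : ∀ r ∈ Ioo (t - δ) t, c ≤ f r) :
    ∃ ε > 0, 0 < ∫ r in (0 : ℝ)..t, (t - r) ^ (α - 1) / (t - r + ε) * f r := by
  have hM0 : 0 ≤ M := (abs_nonneg _).trans (hM 0)
  -- As `ε → 0`, the contribution of `(t - ε, t)` blows up, while the rest is bounded below
  -- independently of `ε`.
  have hlim : Tendsto (fun ε : ℝ => c / (2 * α) * ε ^ (α - 1)) (𝓝[>] 0) atTop :=
    (tendsto_rpow_neg_nhdsGT_zero (by linarith)).const_mul_atTop (by positivity)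
  obtain ⟨ε, hεbig, hε0, hεδ⟩ := ((hlim.eventually_gt_atTop (M * δ ^ (α - 1) / δ * t)).and
    (Ioo_mem_nhdsGT hδ)).exists
  refine ⟨ε, hε0, ?_⟩
  have hI := fun {a b : ℝ} (hab : a ≤ b) (hbt : b ≤ t) =>
    intervalIntegrable_regularized_kernel_mul (t := t) hα0 hε0 hf hM hab hbt
  have hcut : 0 ≤ t - ε := by linarith
  rw [← intervalIntegral.integral_add_adjacent_intervals (hI hcut (by linarith))
    (hI (by linarith) le_rfl)]
  have h1 : -(M * δ ^ (α - 1) / δ * t) ≤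
      ∫ r in (0 : ℝ)..(t - ε), (t - r) ^ (α - 1) / (t - r + ε) * f r := by
    have hK : 0 ≤ M * δ ^ (α - 1) / δ := by positivity
    have hmono : ∫ r in (0 : ℝ)..(t - ε), -(M * δ ^ (α - 1) / δ) ≤
        ∫ r in (0 : ℝ)..(t - ε), (t - r) ^ (α - 1) / (t - r + ε) * f r := by
      refine intervalIntegral.integral_mono_on hcut (by simp) (hI hcut (by linarith)) ?_
      intro r hr
      have hr' : 0 < t - r := by linarith [hr.2]
      have hk : 0 ≤ (t - r) ^ (α - 1) / (t - r + ε) := by positivity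
      by_cases hrδ : t - δ < r
      · have := hfc r ⟨hrδ, by linarith⟩
        have : 0 ≤ (t - r) ^ (α - 1) / (t - r + ε) * f r := mul_nonneg hk (by linarith)
        linarith
      · have hδr : δ ≤ t - r := by linarith
        have hk2 : (t - r) ^ (α - 1) / (t - r + ε) ≤ δ ^ (α - 1) / δ := by
          gcongr ?_ / ?_
          · exact Real.rpow_le_rpow_of_nonpos hδ hδr (by linarith)
          · linarith
        calc -(M * δ ^ (α - 1) / δ) = δ ^ (α - 1) / δ * (-M) := by ring
          _ ≤ (t - r) ^ (α - 1) / (t - r + ε) * (-M) :=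
            mul_le_mul_of_nonpos_right hk2 (by linarith)
          _ ≤ _ := mul_le_mul_of_nonneg_left (neg_le_of_abs_le (hM r)) hk
    rw [intervalIntegral.integral_const, smul_eq_mul, sub_zero] at hmono
    nlinarith
  have h2 : c / (2 * α) * ε ^ (α - 1) ≤
      ∫ r in (t - ε)..t, (t - r) ^ (α - 1) / (t - r + ε) * f r := by
    have hmono : ∫ r in (t - ε)..t, (t - r) ^ (α - 1) * (c / (2 * ε)) ≤
        ∫ r in (t - ε)..t, (t - r) ^ (α - 1) / (t - r + ε) * f r := by
      refine intervalIntegral.integral_mono_on_of_le_Ioo (by linarith)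
        ((intervalIntegrable_sub_rpow hα0 _ _ t).mul_const _) (hI (by linarith) le_rfl) ?_
      intro r hr
      have hr' : 0 < t - r := by linarith [hr.2]
      have hfr := hfc r ⟨by linarith [hr.1], hr.2⟩
      -- On this interval `t - r + ε ≤ 2 * ε`.
      have : c / (2 * ε) ≤ f r / (t - r + ε) := by
        gcongr
        · linarith
        · linarith [hr.1]
      calc _ ≤ (t - r) ^ (α - 1) * (f r / (t - r + ε)) := by gcongr
        _ = _ := by ring
    rw [intervalIntegral.integral_mul_const, integral_sub_rpow hα0] at hmono
    refine le_trans (le_of_eq ?_) hmono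
    rw [sub_sub_cancel, sub_self, Real.zero_rpow hα0.ne', Real.rpow_sub hε0, Real.rpow_one]
    field_simp
    ring
  linarith

theorem rlIntegral_nonneg {β t : ℝ} {f : ℝ → ℝ} (hβ : 0 < β) (ht : 0 ≤ t)
    (hf : ∀ s ∈ Ioo 0 t, 0 ≤ f s) : 0 ≤ rlIntegral β f t := by
  have hΓ := Real.Gamma_pos_of_pos hβ
  unfold rlIntegral
  rw [intervalIntegral.integral_of_le ht, integral_Ioc_eq_integral_Ioo]
  refine mul_nonneg (by positivity) (setIntegral_nonneg measurableSet_Ioo fun s hs => ?_)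
  exact mul_nonneg (Real.rpow_nonneg (by linarith [hs.2]) _) (hf s hs)

/-- Comparison principle: `D^α u ≥ -λ u` and `u(0) = 0` imply `u ≥ 0`. -/
theorem rlIntegral_nonneg_of_neg_mul_le {α lam M T : ℝ} {f : ℝ → ℝ} (hα0 : 0 < α) (hα1 : α < 1)
    (hlam : 0 ≤ lam) (hf : Measurable f) (hM : ∀ s, |f s| ≤ M)
    (h : ∀ s ∈ Ioo 0 T, -lam * rlIntegral α f s ≤ f s) {t : ℝ} (ht : t ∈ Icc 0 T) :
    0 ≤ rlIntegral α f t := by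
  -- For `λ = 0` the lower bound `-λ u` is not strictly positive at a negative minimum, but then `f
  -- ≥ 0` directly.
  rcases hlam.eq_or_lt with rfl | hlam
  · exact rlIntegral_nonneg hα0 ht.1 fun s hs => by
      simpa using h s ⟨hs.1, hs.2.trans_le ht.2⟩
  by_contra! hneg
  set u := rlIntegral α f with hu
  have hcont : ContinuousOn u (Icc 0 T) :=
    (continuousOn_rlIntegral hα0 hα1 hf hM).mono fun s (hs : s ∈ Icc 0 T) => hs.1
  obtain ⟨t₀, ht₀, hmin⟩ := isCompact_Icc.exists_isMinOn ⟨t, ht⟩ hcont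
  have hmin' : ∀ s ∈ Icc 0 T, u t₀ ≤ u s := fun s hs => hmin hs
  have hu0 : u t₀ < 0 := (hmin' t ht).trans_lt hneg
  have ht₀pos : 0 < t₀ := by
    rcases ht₀.1.eq_or_lt with h0 | h0
    · rw [← h0, hu, rlIntegral_zero_right] at hu0
      exact absurd hu0 (lt_irrefl 0)
    · exact h0
  -- Near the minimum `f ≥ -λ u ≥ -λ u(t₀) / 2 > 0`, which supplies the constant `c` below.
  have hev : ∀ᶠ s in 𝓝[Icc 0 T] t₀, u s < u t₀ / 2 :=
    (hcont t₀ ht₀).eventually (gt_mem_nhds (by linarith))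
  obtain ⟨δ, hδ, hball⟩ := Metric.mem_nhdsWithin_iff.1 hev
  obtain ⟨ε, hε, hpos⟩ := exists_integral_regularized_kernel_pos (δ := min δ t₀)
    (c := -lam * (u t₀ / 2)) (t := t₀) hα0 hα1 (lt_min hδ ht₀pos) (min_le_right _ _)
    (by nlinarith) hf hM (by
      intro r hr
      have hr1 : r ∈ Ioo 0 T := ⟨by linarith [hr.1, min_le_right δ t₀], hr.2.trans_le ht₀.2⟩
      have hr2 : u r < u t₀ / 2 := hball ⟨by
        rw [Metric.mem_ball, Real.dist_eq, abs_sub_lt_iff]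
        constructor <;> linarith [hr.1, hr.2, min_le_left δ t₀], Ioo_subset_Icc_self hr1⟩
      exact le_trans (by nlinarith) (h r hr1))
  have hle := integral_regularized_kernel_nonpos hα0 ht₀pos hε hf hM
    (hcont.mono (Icc_subset_Icc_right ht₀.2))
    (fun s hs => hmin' s ⟨hs.1, hs.2.trans ht₀.2⟩) hu0.le
  linarith

/-- A priori bound for `D^α u + λ u = k`, `u(0) = 0`, where `f = k - λ u` is the derivative. -/
theorem abs_rlIntegral_le_of_abs_add_le {α lam M N T : ℝ} {f : ℝ → ℝ} (hα0 : 0 < α) (hα1 : α < 1)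
    (hlam : 0 ≤ lam) (hf : Measurable f) (hM : ∀ s, |f s| ≤ M) (hN : 0 ≤ N)
    (h : ∀ s ∈ Ioo 0 T, |f s + lam * rlIntegral α f s| ≤ N) {t : ℝ} (ht : t ∈ Icc 0 T) :
    |rlIntegral α f t| ≤ N * T ^ α / Real.Gamma (α + 1) := by
  have hΓ := Real.Gamma_pos_of_pos (show 0 < α + 1 by linarith)
  have hT : N * t ^ α / Real.Gamma (α + 1) ≤ N * T ^ α / Real.Gamma (α + 1) := by
    have := Real.rpow_le_rpow ht.1 ht.2 hα0.le
    gcongr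
  have hconst : ∀ s : ℝ, |(fun _ : ℝ => N) s| ≤ N := fun s => by simp [abs_of_nonneg hN]
  -- The comparison function is `N t^α / Γ(α+1) - c u = I^α (N - c f)` with `c = ±1`. Its extra term
  -- `λ N t^α / Γ(α+1)` is nonnegative, so `λ` drops out of the bound.
  have key : ∀ c : ℝ, |c| = 1 → c * rlIntegral α f t ≤ N * t ^ α / Real.Gamma (α + 1) := by
    intro c hc
    have hcf : ∀ s, |-c * f s| ≤ M := fun s => by simpa [abs_mul, hc] using hM s
    have hsplit : ∀ s, rlIntegral α (fun r => N + -c * f r) s =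
        N * s ^ α / Real.Gamma (α + 1) + -c * rlIntegral α f s := fun s => by
      rw [rlIntegral_add hα0 measurable_const hconst (hf.const_mul (-c)) hcf,
        rlIntegral_const hα0, rlIntegral_const_mul]
    have h0 := rlIntegral_nonneg_of_neg_mul_le (f := fun r => N + -c * f r) (M := N + M)
      (T := T) (lam := lam) hα0 hα1 hlam (by fun_prop)
      (fun s => (abs_add_le _ _).trans (add_le_add (hconst s) (hcf s))) (by
        intro s hs
        rw [hsplit]
        have h1 : c * (f s + lam * rlIntegral α f s) ≤ N := by
          refine (le_abs_self _).trans ?_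
          rw [abs_mul, hc, one_mul]
          exact h s hs
        have hs0 : 0 < s := hs.1
        have h2 : 0 ≤ lam * (N * s ^ α / Real.Gamma (α + 1)) := by positivity
        linarith) ht
    rw [hsplit] at h0
    linarith
  rw [abs_le]
  constructor
  · linarith [key (-1) (by simp)]
  · linarith [key 1 (by simp)]

/-! ### The linear problem, solved by continuation in `λ`. -/

theorem abs_IccExtend_le_norm {a b : ℝ} (hab : a ≤ b) (h : C(Icc a b, ℝ)) (s : ℝ) :
    |IccExtend hab h s| ≤ ‖h‖ :=
  h.norm_coe_le_norm _

theorem continuous_IccExtend {a b : ℝ} (hab : a ≤ b) (h : C(Icc a b, ℝ)) :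
    Continuous (IccExtend hab h) :=
  h.continuous.Icc_extend'

/-- `u` is the mild solution of `D^α u + λ u = h`, `u(0) = 0`, on `[0,T]`. -/
def IsLinearSolution (α lam : ℝ) {T : ℝ} (hT : 0 ≤ T) (h u : C(Icc 0 T, ℝ)) : Prop :=
  ∀ t : Icc 0 T, u t = rlIntegral α (fun s => IccExtend hT h s - lam * IccExtend hT u s) t

theorem abs_sub_mul_le {p q M N lam : ℝ} (hp : |p| ≤ M) (hq : |q| ≤ N) (hlam : 0 ≤ lam) :
    |p - lam * q| ≤ M + lam * N := by
  refine (abs_sub _ _).trans (add_le_add hp ?_)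
  rw [abs_mul, abs_of_nonneg hlam]
  gcongr

theorem rlIntegral_sub {β M N : ℝ} {f g : ℝ → ℝ} (hβ : 0 < β) (hf : Measurable f)
    (hM : ∀ s, |f s| ≤ M) (hg : Measurable g) (hN : ∀ s, |g s| ≤ N) (t : ℝ) :
    rlIntegral β (fun s => f s - g s) t = rlIntegral β f t - rlIntegral β g t := by
  have h := rlIntegral_add (f := f) (g := fun s => -1 * g s) hβ hf hM (hg.const_mul _)
    (by simpa using hN) t
  rw [rlIntegral_const_mul] at h
  simpa [sub_eq_add_neg] using h

theorem IsLinearSolution.dist_le {α lam T : ℝ} (hα0 : 0 < α) (hα1 : α < 1) (hlam : 0 ≤ lam)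
    {hT : 0 ≤ T} {h₁ h₂ u₁ u₂ : C(Icc 0 T, ℝ)} (H₁ : IsLinearSolution α lam hT h₁ u₁)
    (H₂ : IsLinearSolution α lam hT h₂ u₂) :
    dist u₁ u₂ ≤ T ^ α / Real.Gamma (α + 1) * dist h₁ h₂ := by
  have hΓ := Real.Gamma_pos_of_pos (show 0 < α + 1 by linarith)
  have hmeas : ∀ h u : C(Icc 0 T, ℝ),
      Measurable fun s => IccExtend hT h s - lam * IccExtend hT u s := fun h u =>
    ((continuous_IccExtend hT h).sub
      (continuous_const.mul (continuous_IccExtend hT u))).measurable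
  have hbdd : ∀ (h u : C(Icc 0 T, ℝ)) (s : ℝ),
      |IccExtend hT h s - lam * IccExtend hT u s| ≤ ‖h‖ + lam * ‖u‖ := fun h u s =>
    abs_sub_mul_le (abs_IccExtend_le_norm hT h s) (abs_IccExtend_le_norm hT u s) hlam
  have hdiff : ∀ t : Icc 0 T, u₁ t - u₂ t = rlIntegral α (fun s =>
      (IccExtend hT h₁ s - lam * IccExtend hT u₁ s) -
        (IccExtend hT h₂ s - lam * IccExtend hT u₂ s)) t := fun t => by
    rw [rlIntegral_sub hα0 (hmeas h₁ u₁) (hbdd h₁ u₁) (hmeas h₂ u₂) (hbdd h₂ u₂), ← H₁ t, ← H₂ t]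
  rw [ContinuousMap.dist_le (by positivity)]
  intro t
  rw [Real.dist_eq, hdiff t]
  refine (abs_rlIntegral_le_of_abs_add_le (T := T) hα0 hα1 hlam
    ((hmeas h₁ u₁).sub (hmeas h₂ u₂)) (fun s => (abs_sub _ _).trans
      (add_le_add (hbdd h₁ u₁ s) (hbdd h₂ u₂ s))) dist_nonneg ?_ t.2).trans (le_of_eq (by ring))
  intro s hs
  have hs' : s ∈ Icc 0 T := Ioo_subset_Icc_self hs
  simp only [Pi.sub_def]
  rw [← hdiff ⟨s, hs'⟩]
  simp only [IccExtend_of_mem hT _ hs']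
  have := ContinuousMap.dist_apply_le_dist (f := h₁) (g := h₂) ⟨s, hs'⟩
  rw [Real.dist_eq] at this
  refine le_trans (le_of_eq ?_) this
  congr 1
  ring

theorem exists_isLinearSolution_zero {α T : ℝ} (hα0 : 0 < α) (hα1 : α < 1) (hT : 0 ≤ T)
    (h : C(Icc 0 T, ℝ)) : ∃ u, IsLinearSolution α 0 hT h u := by
  have hc : ContinuousOn (rlIntegral α (IccExtend hT h)) (Icc 0 T) :=
    (continuousOn_rlIntegral hα0 hα1 (continuous_IccExtend hT h).measurable
      (abs_IccExtend_le_norm hT h)).mono fun s (hs : s ∈ Icc 0 T) => hs.1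
  refine ⟨⟨_, continuousOn_iff_continuous_domRestrict.1 hc⟩, fun t => ?_⟩
  simp only [zero_mul, sub_zero]
  rfl

/-- Moving `η u` to the right makes `u` a fixed point of `x ↦ S (h - η x)`, with `S` the solution
operator for `lam`; it is a contraction by `IsLinearSolution.dist_le`. -/
theorem exists_isLinearSolution_add {α lam η T : ℝ} (hα0 : 0 < α) (hα1 : α < 1) (hT : 0 ≤ T)
    (hlam : 0 ≤ lam) (hη : 0 ≤ η) (hηT : T ^ α / Real.Gamma (α + 1) * η < 1)
    (hS : ∀ h : C(Icc 0 T, ℝ), ∃ u, IsLinearSolution α lam hT h u) (h : C(Icc 0 T, ℝ)) :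
    ∃ u, IsLinearSolution α (lam + η) hT h u := by
  have hΓ := Real.Gamma_pos_of_pos (show 0 < α + 1 by linarith)
  choose S hS using hS
  have hK : 0 ≤ T ^ α / Real.Gamma (α + 1) * η := by positivity
  have hcontr : ContractingWith ⟨_, hK⟩ fun x => S (h - η • x) := by
    refine ⟨by exact_mod_cast hηT, LipschitzWith.of_dist_le_mul fun x y => ?_⟩
    refine ((hS _).dist_le hα0 hα1 hlam (hS _)).trans (le_of_eq ?_)
    change _ = T ^ α / Real.Gamma (α + 1) * η * dist x y
    rw [dist_sub_left, dist_eq_norm, ← smul_sub, norm_smul, Real.norm_eq_abs,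
      abs_of_nonneg hη, ← mul_assoc, dist_eq_norm]
  refine ⟨hcontr.fixedPoint, fun t => ?_⟩
  set x := hcontr.fixedPoint
  have hx : S (h - η • x) = x := hcontr.fixedPoint_isFixedPt
  have := hS (h - η • x) t
  rw [hx] at this
  rw [this]
  congr 1
  ext s
  simp only [IccExtend, Function.comp_apply, ContinuousMap.sub_apply, ContinuousMap.smul_apply,
    smul_eq_mul]
  ring

theorem exists_isLinearSolution {α lam T : ℝ} (hα0 : 0 < α) (hα1 : α < 1) (hT : 0 ≤ T)
    (hlam : 0 ≤ lam) (h : C(Icc 0 T, ℝ)) : ∃ u, IsLinearSolution α lam hT h u := by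
  have hΓ := Real.Gamma_pos_of_pos (show 0 < α + 1 by linarith)
  obtain ⟨n, hn⟩ := exists_nat_gt (T ^ α / Real.Gamma (α + 1) * lam)
  have hn0 : (0 : ℝ) < n := lt_of_le_of_lt (by positivity) hn
  -- One step size serves every stage, because the Lipschitz constant of the solution operator does
  -- not depend on the current `λ`.
  have hstep : T ^ α / Real.Gamma (α + 1) * (lam / n) < 1 := by
    rw [← mul_div_assoc, div_lt_one hn0]
    exact hn
  have hη : 0 ≤ lam / n := by positivity
  have key : ∀ k : ℕ, ∀ h : C(Icc 0 T, ℝ), ∃ u, IsLinearSolution α (k * (lam / n)) hT h u := by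
    intro k
    induction k with
    | zero =>
      intro h
      simpa using exists_isLinearSolution_zero hα0 hα1 hT h
    | succ k ih =>
      intro h
      rw [Nat.cast_succ, add_one_mul]
      exact exists_isLinearSolution_add hα0 hα1 hT (by positivity) hη hstep ih h
  simpa [mul_div_cancel₀ _ hn0.ne'] using key n h

/-! ### The delayed problem: existence and stability. -/

theorem val_of_mem {v T t : ℝ} (x : C(Icc (-v) T, ℝ)) (ht : t ∈ Icc (-v) T) :
    val x t = x ⟨t, ht⟩ :=
  dif_pos ht

theorem continuousOn_val {v T : ℝ} (x : C(Icc (-v) T, ℝ)) :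
    ContinuousOn (val x) (Icc (-v) T) := by
  rw [continuousOn_iff_continuous_domRestrict]
  exact x.continuous.congr fun t => (val_of_mem x t.2).symm

theorem abs_val_sub_val_le {v T : ℝ} (x y : C(Icc (-v) T, ℝ)) (t : ℝ) :
    |val x t - val y t| ≤ dist x y := by
  by_cases ht : t ∈ Icc (-v) T
  · rw [val_of_mem x ht, val_of_mem y ht, ← Real.dist_eq]
    exact ContinuousMap.dist_apply_le_dist _
  · simp [val, ht]

theorem abs_le_supAbs {T t : ℝ} {f : ℝ → ℝ} (hf : ContinuousOn f (Icc 0 T)) (ht : t ∈ Icc 0 T) :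
    |f t| ≤ supAbs T f := by
  obtain ⟨M, hM⟩ := isCompact_Icc.exists_bound_of_continuousOn hf
  exact le_ciSup (f := fun t : Icc (0 : ℝ) T => |f t|) ⟨M, by rintro _ ⟨s, rfl⟩; exact hM s s.2⟩
    ⟨t, ht⟩

theorem supAbs_nonneg (T : ℝ) (f : ℝ → ℝ) : 0 ≤ supAbs T f :=
  Real.iSup_nonneg fun _ => abs_nonneg _

theorem continuousOn_delayedStress {n : ℕ} {v T : ℝ} {τ : Fin n → ℝ} {b : Fin n → ℝ → ℝ}
    {g : Fin n → C(Icc (-v) T, ℝ) → C(Icc (-v) T, ℝ)} (hτ : ∀ j, 0 ≤ τ j) (hτv : ∀ j, τ j ≤ v)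
    (hb : ∀ j, ContinuousOn (b j) (Icc 0 T)) (x : C(Icc (-v) T, ℝ)) :
    ContinuousOn (delayedStress τ b g x) (Icc 0 T) := by
  refine continuousOn_finsetSum _ fun j _ => (hb j).mul ?_
  refine (continuousOn_val (g j x)).comp (by fun_prop) fun t ht => ?_
  exact ⟨by linarith [ht.1, hτv j], by linarith [ht.2, hτ j]⟩

theorem abs_delayedStress_sub_le {n : ℕ} {v T : ℝ} {τ : Fin n → ℝ} {b : Fin n → ℝ → ℝ}
    {g : Fin n → C(Icc (-v) T, ℝ) → C(Icc (-v) T, ℝ)} {l : Fin n → ℝ≥0}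
    (hb : ∀ j, ContinuousOn (b j) (Icc 0 T)) (hg : ∀ j, LipschitzWith (l j) (g j))
    (x y : C(Icc (-v) T, ℝ)) {t : ℝ} (ht : t ∈ Icc 0 T) :
    |delayedStress τ b g x t - delayedStress τ b g y t| ≤
      (∑ j, supAbs T (b j) * (l j : ℝ)) * dist x y := by
  unfold delayedStress
  rw [← Finset.sum_sub_distrib, Finset.sum_mul]
  refine (Finset.abs_sum_le_sum_abs _ _).trans (Finset.sum_le_sum fun j _ => ?_)
  rw [← mul_sub, abs_mul, mul_assoc]
  exact mul_le_mul (abs_le_supAbs (hb j) ht)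
    ((abs_val_sub_val_le _ _ _).trans ((hg j).dist_le_mul x y)) (abs_nonneg _)
    (supAbs_nonneg _ _)

/-- The inequality itself bounds the Caputo derivative, since all its other terms are continuous on
a compact interval; this is what the inversion lemma needs. -/
theorem IsApproxSolution.exists_eqOn_rlIntegral {n : ℕ} {α lam ε v T : ℝ} {τ : Fin n → ℝ}
    {b : Fin n → ℝ → ℝ} {g : Fin n → C(Icc (-v) T, ℝ) → C(Icc (-v) T, ℝ)} {ψ : ℝ → ℝ}
    {y : C(Icc (-v) T, ℝ)} (hα0 : 0 < α) (hα1 : α < 1) (hτ : ∀ j, 0 ≤ τ j) (hτv : ∀ j, τ j ≤ v)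
    (hv0 : 0 ≤ v) (hT : 0 < T) (hb : ∀ j, ContinuousOn (b j) (Icc 0 T)) (hψ0 : ψ 0 = 0)
    (hy : IsApproxSolution α lam τ b g ψ ε y) :
    ∃ (f : ℝ → ℝ) (M : ℝ), Measurable f ∧ (∀ s, |f s| ≤ M) ∧
      EqOn (val y) (rlIntegral α f) (Icc 0 T) ∧
      ∀ s ∈ Ioo 0 T, |f s + lam * val y s - delayedStress τ b g y s| ≤ ε := by
  have hsub : Icc 0 T ⊆ Icc (-v) T := Icc_subset_Icc_left (by linarith)
  have hy0 : val y 0 = 0 := by rw [hy.1 0 ⟨by linarith, le_rfl⟩, hψ0]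
  have hval := (continuousOn_val y).mono hsub
  obtain ⟨C, hC⟩ := isCompact_Icc.exists_bound_of_continuousOn
    ((continuousOn_const (c := lam)).mul hval |>.sub
      (continuousOn_delayedStress (g := g) hτ hτv hb y))
  have h2 := hy.2
  simp only [HasCaputoDerivAt, hy0, sub_zero] at h2
  choose! d hd using h2
  have hdM : ∀ t ∈ Icc 0 T, |d t| ≤ ε + C := by
    intro t ht
    have h3 := (hd t ht).2
    have h4 : |lam * val y t - delayedStress τ b g y t| ≤ C := hC t ht
    rw [abs_le] at h3 h4 ⊢
    constructor <;> linarith [h3.1, h3.2, h4.1, h4.2]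
  obtain ⟨f, hf, hfM, hfd, hyf⟩ := exists_eqOn_rlIntegral_of_hasDerivWithinAt hα0 hα1 hT hval
    (fun t ht => (hd t ht).1) hdM
  refine ⟨f, ε + C, hf, hfM, hyf, fun s hs => ?_⟩
  rw [hfd hs]
  exact (hd s (Ioo_subset_Icc_self hs)).2

/-- Two approximate solutions with the same history are close. -/
theorem IsApproxSolution.dist_le {n : ℕ} {α lam ε₁ ε₂ v T : ℝ} {τ : Fin n → ℝ}
    {b : Fin n → ℝ → ℝ} {g : Fin n → C(Icc (-v) T, ℝ) → C(Icc (-v) T, ℝ)} {l : Fin n → ℝ≥0}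
    {ψ : ℝ → ℝ} {x y : C(Icc (-v) T, ℝ)} (hα0 : 0 < α) (hα1 : α < 1) (hlam : 0 ≤ lam)
    (hτ : ∀ j, 0 ≤ τ j) (hτv : ∀ j, τ j ≤ v) (hv0 : 0 ≤ v) (hT : 0 < T)
    (hb : ∀ j, ContinuousOn (b j) (Icc 0 T)) (hg : ∀ j, LipschitzWith (l j) (g j))
    (hCL : T ^ α * ∑ j, supAbs T (b j) * (l j : ℝ) < Real.Gamma (α + 1)) (hψ0 : ψ 0 = 0)
    (hε₁ : 0 ≤ ε₁) (hε₂ : 0 ≤ ε₂) (hx : IsApproxSolution α lam τ b g ψ ε₁ x)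
    (hy : IsApproxSolution α lam τ b g ψ ε₂ y) :
    dist x y ≤ T ^ α / (Real.Gamma (α + 1) - T ^ α * ∑ j, supAbs T (b j) * (l j : ℝ)) *
      (ε₁ + ε₂) := by
  have hΓ := Real.Gamma_pos_of_pos (show 0 < α + 1 by linarith)
  obtain ⟨f₁, M₁, hf₁, hM₁, hx₁, he₁⟩ := hx.exists_eqOn_rlIntegral hα0 hα1 hτ hτv hv0 hT hb hψ0
  obtain ⟨f₂, M₂, hf₂, hM₂, hy₂, he₂⟩ := hy.exists_eqOn_rlIntegral hα0 hα1 hτ hτv hv0 hT hb hψ0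
  set L := ∑ j, supAbs T (b j) * (l j : ℝ) with hL
  have hL0 : 0 ≤ L := Finset.sum_nonneg fun j _ => mul_nonneg (supAbs_nonneg _ _) (l j).2
  -- The difference satisfies the linear inequality with both errors plus the Lipschitz change of
  -- the delayed stress.
  set N := ε₁ + ε₂ + L * dist x y with hN
  have hN0 : 0 ≤ N := by positivity
  have hdiff : ∀ t ∈ Icc 0 T,
      val x t - val y t = rlIntegral α (fun s => f₁ s - f₂ s) t := fun t ht => by
    rw [rlIntegral_sub hα0 hf₁ hM₁ hf₂ hM₂, ← hx₁ ht, ← hy₂ ht]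
  have hbound : ∀ t ∈ Icc 0 T, |val x t - val y t| ≤ N * T ^ α / Real.Gamma (α + 1) := by
    intro t ht
    rw [hdiff t ht]
    refine abs_rlIntegral_le_of_abs_add_le hα0 hα1 hlam (hf₁.sub hf₂) (M := M₁ + M₂)
      (fun s => (abs_sub _ _).trans (add_le_add (hM₁ s) (hM₂ s))) hN0 ?_ ht
    intro s hs
    have hs' : s ∈ Icc 0 T := Ioo_subset_Icc_self hs
    simp only [Pi.sub_def]
    rw [← hdiff s hs']
    have h1 := he₁ s hs
    have h2 := he₂ s hs
    have h3 := abs_delayedStress_sub_le (τ := τ) hb hg x y hs'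
    rw [abs_le] at h1 h2 h3 ⊢
    constructor <;> linarith [h1.1, h1.2, h2.1, h2.2, h3.1, h3.2]
  have hdist : dist x y ≤ N * T ^ α / Real.Gamma (α + 1) := by
    rw [ContinuousMap.dist_le (by positivity)]
    intro t
    rw [Real.dist_eq, ← val_of_mem x t.2, ← val_of_mem y t.2]
    rcases le_total (t : ℝ) 0 with h | h
    · rw [hx.1 t ⟨t.2.1, h⟩, hy.1 t ⟨t.2.1, h⟩, sub_self, abs_zero]
      positivity
    · exact hbound t ⟨h, t.2.2⟩
  -- The term `T^α * L * dist x y` is absorbed on the left, where (CL) keeps the coefficient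
  -- positive.
  rw [le_div_iff₀ hΓ, hN] at hdist
  rw [div_mul_eq_mul_div, le_div_iff₀ (by linarith)]
  linarith

theorem IsSolution.isApproxSolution {n : ℕ} {α lam ε v T : ℝ} {τ : Fin n → ℝ}
    {b : Fin n → ℝ → ℝ} {g : Fin n → C(Icc (-v) T, ℝ) → C(Icc (-v) T, ℝ)} {ψ : ℝ → ℝ}
    {x : C(Icc (-v) T, ℝ)} (hx : IsSolution α lam τ b g ψ x) (hε : 0 ≤ ε) :
    IsApproxSolution α lam τ b g ψ ε x := by
  refine ⟨hx.1, fun t ht => ?_⟩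
  obtain ⟨d, hd, h⟩ := hx.2 t ht
  exact ⟨d, hd, by rw [h, sub_self, abs_zero]; exact hε⟩

/-- The function on `[-v,T]` with history `ψ` that continues as `u` on `[0,T]`, provided
`ψ(0) = u(0) = 0`. -/
noncomputable def extendByHistory {v T : ℝ} (hv : 0 ≤ v) (hT : 0 ≤ T) {ψ : ℝ → ℝ}
    (hψ : ContinuousOn ψ (Icc (-v) 0)) (u : C(Icc 0 T, ℝ)) : C(Icc (-v) T, ℝ) where
  toFun t := ψ (min t 0) + IccExtend hT u t
  continuous_toFun := by
    refine Continuous.add ?_ ((continuous_IccExtend hT u).comp continuous_subtype_val)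
    exact hψ.comp_continuous (by fun_prop) fun t =>
      ⟨le_min t.2.1 (by linarith), min_le_right _ _⟩

theorem exists_isSolution {n : ℕ} {α lam v T : ℝ} {τ : Fin n → ℝ}
    {b : Fin n → ℝ → ℝ} {g : Fin n → C(Icc (-v) T, ℝ) → C(Icc (-v) T, ℝ)} {l : Fin n → ℝ≥0}
    {ψ : ℝ → ℝ} (hα0 : 0 < α) (hα1 : α < 1) (hlam : 0 ≤ lam)
    (hτ : ∀ j, 0 ≤ τ j) (hτv : ∀ j, τ j ≤ v) (hv0 : 0 ≤ v) (hT : 0 < T)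
    (hb : ∀ j, ContinuousOn (b j) (Icc 0 T)) (hg : ∀ j, LipschitzWith (l j) (g j))
    (hCL : T ^ α * ∑ j, supAbs T (b j) * (l j : ℝ) < Real.Gamma (α + 1))
    (hψ : ContinuousOn ψ (Icc (-v) 0)) (hψ0 : ψ 0 = 0) :
    ∃ x : C(Icc (-v) T, ℝ), IsSolution α lam τ b g ψ x := by
  have hΓ := Real.Gamma_pos_of_pos (show 0 < α + 1 by linarith)
  have hsub : Icc 0 T ⊆ Icc (-v) T := Icc_subset_Icc_left (by linarith)
  set L := ∑ j, supAbs T (b j) * (l j : ℝ) with hL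
  have hL0 : 0 ≤ L := Finset.sum_nonneg fun j _ => mul_nonneg (supAbs_nonneg _ _) (l j).2
  choose S hS using fun h : C(Icc 0 T, ℝ) => exists_isLinearSolution hα0 hα1 hT.le hlam h
  let F : C(Icc (-v) T, ℝ) → C(Icc 0 T, ℝ) := fun x =>
    ⟨_, continuousOn_iff_continuous_domRestrict.1 (continuousOn_delayedStress (g := g) hτ hτv hb x)⟩
  have hFapply : ∀ x (t : Icc 0 T), F x t = delayedStress τ b g x t := fun _ _ => rfl
  have hF : ∀ x y, dist (F x) (F y) ≤ L * dist x y := fun x y => by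
    rw [ContinuousMap.dist_le (by positivity)]
    intro t
    rw [Real.dist_eq]
    exact abs_delayedStress_sub_le hb hg x y t.2
  have hK : 0 ≤ T ^ α / Real.Gamma (α + 1) * L := by positivity
  -- Gluing on the common history does not increase distances, so the constant is the linear one
  -- times `L`, which is below `1` exactly by (CL).
  have hcontr : ContractingWith ⟨_, hK⟩ fun x => extendByHistory hv0 hT.le hψ (S (F x)) := by
    constructor
    · change T ^ α / Real.Gamma (α + 1) * L < 1
      rwa [div_mul_eq_mul_div, div_lt_one hΓ]
    · refine LipschitzWith.of_dist_le_mul fun x y => ?_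
      have h1 : dist (extendByHistory hv0 hT.le hψ (S (F x)))
          (extendByHistory hv0 hT.le hψ (S (F y))) ≤ dist (S (F x)) (S (F y)) := by
        rw [ContinuousMap.dist_le dist_nonneg]
        intro t
        change dist (ψ (min t 0) + _) (ψ (min t 0) + _) ≤ _
        rw [dist_add_left]
        exact ContinuousMap.dist_apply_le_dist _
      refine h1.trans (((hS _).dist_le hα0 hα1 hlam (hS _)).trans ?_)
      change _ ≤ T ^ α / Real.Gamma (α + 1) * L * dist x y
      rw [mul_assoc]
      exact mul_le_mul_of_nonneg_left (hF x y) (by positivity)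
  set x := hcontr.fixedPoint
  set u := S (F x)
  have hxfix : extendByHistory hv0 hT.le hψ u = x := hcontr.fixedPoint_isFixedPt
  have hu : IsLinearSolution α lam hT.le (F x) u := hS (F x)
  -- For `t ≤ 0` the constant extension of `u` takes the value `u(0)`; its vanishing preserves the
  -- history.
  have hu0 : u ⟨0, le_rfl, hT.le⟩ = 0 := by rw [hu, rlIntegral_zero_right]
  have hxapply : ∀ t ∈ Icc (-v) T, val x t = ψ (min t 0) + IccExtend hT.le u t := by
    intro t ht
    rw [val_of_mem x ht]
    conv_lhs => rw [← hxfix]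
    rfl
  have hhist : ∀ t ∈ Icc (-v) 0, val x t = ψ t := by
    intro t ht
    rw [hxapply t ⟨ht.1, ht.2.trans hT.le⟩, min_eq_left ht.2, IccExtend_of_le_left hT.le _ ht.2,
      hu0, add_zero]
  have hx0 : val x 0 = 0 := by rw [hhist 0 ⟨by linarith, le_rfl⟩, hψ0]
  have hxu : ∀ t ∈ Icc 0 T, val x t = IccExtend hT.le u t := by
    intro t ht
    rw [hxapply t (hsub ht), min_eq_right ht.1, hψ0, zero_add]
  refine ⟨x, hhist, fun t ht => ⟨delayedStress τ b g x t - lam * val x t, ?_, by ring⟩⟩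
  simp only [HasCaputoDerivAt, hx0, sub_zero]
  refine hasDerivWithinAt_rlIntegral_of_eqOn
    (f := fun t => delayedStress τ b g x t - lam * val x t) hα0 hα1 hT.le
    ((continuousOn_delayedStress hτ hτv hb x).sub
      (continuousOn_const.mul ((continuousOn_val x).mono hsub))) ?_ ht
  intro s hs
  simp only
  rw [hxu s hs, IccExtend_of_mem hT.le _ hs, hu]
  refine rlIntegral_congr hs.1 fun r hr => ?_
  have hr' : r ∈ Icc 0 T := ⟨hr.1.le, hr.2.le.trans hs.2⟩
  rw [hxu r hr', IccExtend_of_mem hT.le (F x) hr', hFapply]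

end FractionalCreep

theorem theorem4 {n : ℕ} {α lam T v : ℝ} (hα0 : 0 < α) (hα1 : α < 1) (hlam : 0 < lam)
    (τ : Fin n → ℝ) (hτ : ∀ j, 0 ≤ τ j) (hv : IsGreatest (Set.range τ) v)
    (hv0 : 0 < v) (hvT : v ≤ T)
    (b : Fin n → ℝ → ℝ) (hb : ∀ j, ContinuousOn (b j) (Set.Icc 0 T))
    (g : Fin n → C(Set.Icc (-v) T, ℝ) → C(Set.Icc (-v) T, ℝ))
    (l : Fin n → ℝ≥0) (hg : ∀ j, LipschitzWith (l j) (g j))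
    (hCL : T ^ α * ∑ j, FractionalCreep.supAbs T (b j) * (l j : ℝ) < Real.Gamma (α + 1))
    (ψ : ℝ → ℝ) (hψ : ContinuousOn ψ (Set.Icc (-v) 0)) (hψ0 : ψ 0 = 0) :
    (∃! x : C(Set.Icc (-v) T, ℝ), FractionalCreep.IsSolution α lam τ b g ψ x) ∧
    FractionalCreep.IsUlamHyersStableWith α lam τ b g ψ
      (T ^ α / (Real.Gamma (α + 1) -
        T ^ α * ∑ j, FractionalCreep.supAbs T (b j) * (l j : ℝ))) := by
  have hT : 0 < T := hv0.trans_le hvT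
  have hτv : ∀ j, τ j ≤ v := fun j => hv.2 ⟨j, rfl⟩
  obtain ⟨x, hx⟩ := FractionalCreep.exists_isSolution hα0 hα1 hlam.le hτ hτv hv0.le hT hb hg hCL
    hψ hψ0
  refine ⟨⟨x, hx, fun y hy => ?_⟩, div_pos (Real.rpow_pos_of_pos hT α) (by linarith),
    fun ε hε y hy => ⟨x, hx, fun t => ?_⟩⟩
  -- Uniqueness is the stability estimate with both errors equal to `0`.
  · have h := (hy.isApproxSolution le_rfl).dist_le hα0 hα1 hlam.le hτ hτv hv0.le hT hb hg hCL hψ0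
      le_rfl le_rfl (hx.isApproxSolution le_rfl)
    rw [add_zero, mul_zero] at h
    exact dist_le_zero.1 h
  · have h := hy.dist_le hα0 hα1 hlam.le hτ hτv hv0.le hT hb hg hCL hψ0
      hε.le le_rfl (hx.isApproxSolution le_rfl)
    rw [add_zero] at h
    rw [← Real.dist_eq]
    exact (ContinuousMap.dist_apply_le_dist t).trans h
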